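/- Conventions. Fix a universe of sets. A \emph{domain} is an arbitrary collection (possibly a proper class, possibly even larger); it is called a \emph{set} if it is in bijection with a member of the universe. $\mathbb W$ denotes the domain of all ordinals of the universe (order-isomorphism classes of well-ordered sets); it is not a set. A \emph{binary function} on a domain $A$ is a function $A\to\{\text{yes},\text{no}\}$, identified with its support, and $\mathrm P[A]$ is the collection of all of them. $\mathrm{bP}[\mathbb W]$ is the collection of those binary functions on $\mathbb W$ whose support is bounded above. A \emph{pairing} $\epsilon$ on $A$ is a function $\epsilon\colon A\times A\to\{\text{yes},\text{no}\}$; its \emph{opposite adjoint} is $\epsilon^{\rm opadj}\colon A\to \mathrm P[A]$, $a\mapsto\epsilon[\#,a]$. The pairing is \emph{extensional} if $\epsilon^{\rm opadj}$ is injective. A subdomain $B\subset A$ is \emph{$\epsilon$-transitive} if $b\in B$ and $\epsilon[a,b]=\text{yes}$ imply $a\in B$. $(A,\epsilon)$ is \emph{well-founded} if $A$ is a set and for every transitive $B\subset A$ with $A\setminus B\neq\emptyset$ there is $c\in A\setminus B$ such that $\epsilon[a,c]=\text{yes}$ implies $a\in B$. For $a\in A$, $\mathrm{tcl}[a]$ is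 the domain of all $x$ for which there is a finite chain $c_0=a,c_1,\dots,c_n=x$, $n\ge1$, with $\epsilon[c_{i+1},c_i]=\text{yes}$ for all $i$. $(A,\epsilon)$ is \emph{almost well-founded} if the restriction of $\epsilon$ to $\mathrm{tcl}[a]$ is well-founded for every $a\in A$. A function $f\colon A\to B$ is a \emph{morphism of pairings} $(A,\epsilon)\to(B,\delta)$ if $\epsilon[x,y]=\delta[f(x),f(y)]$ for all $x,y\in A$. Let $\beth\colon\mathbb W\to\mathbb W$ be given by $\beth[0]=\omega$, $\beth[a+1]=$ the initial ordinal of cardinality $2^{|\beth[a]|}$, and $\beth[a]=\sup_{b<a}\beth[b]$ for nonzero limit $a$. For $x\in\mathbb W$ put $\mathrm{rank}[x]=\min\{a\mid x<\beth[a]\}$, and for $h\in\mathrm{bP}[\mathbb W]$ let $\mathrm{rank}[h]$ be the least ordinal that is $\ge\mathrm{rank}[x]$ for all $x$ in the support of $h$. \textbf{Theorem.} \emph{Existence.} There is a pairing $\in$ on $\mathbb W$ such that $\in^{\rm opadj}$ is a bijection from $\mathbb W$ onto $\mathrm{bP}[\mathbb W]$ and (1) its restriction to $\mathbb N$ is the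 canonical order isomorphism from $\mathbb N$ onto the finite subsets of $\mathbb N$, where distinct finite subsets $s,t$ are ordered by $s<t$ iff the largest element of their symmetric difference lies in $t$; (2) if $x\in\mathbb W\setminus\mathbb N$ then $\mathrm{rank}[x]=\mathrm{rank}[\in^{\rm opadj}[x]]+1$. Moreover, every pairing $\in$ on $\mathbb W$ with these properties satisfies the following. \emph{Universality.} If $(A,\epsilon)$ is any almost well-founded extensional pairing, then there is a unique injective function $\omega\colon A\to\mathbb W$ with $\in$-transitive image that is a morphism of pairings from $\epsilon$ to the restriction of $\in$ to the image of $\omega$. \emph{Set theory.} $(\mathbb W,\in)$ satisfies the ZFC axioms, with Separation and Replacement for arbitrary (not only first-order definable) predicates and functions. Writing $x\in a$ for $\in[x,a]=\text{yes}$, these are: $\in$ is almost well-founded (Regularity); Extensionality; Pairing; Union; Powerset; Infinity (some $a$ has infinitely many elements, and there is an $a$ containing $\emptyset$ and closed under $x\mapsto x\cup\{x\}$); Choice (there is a function that picks, for each $a$ whose elements are not all of $\mathbb W$, an element of $\mathbb W$ not in $a$; and for each $a$ whose elements are nonempty and pairwise disjoint there is a $t$ that has exactly one element in common with each element of $a$);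 Separation (for every binary function $P$ on $\mathbb W$ and every $a$ there is a $b$ with $x\in b\Leftrightarrow x\in a$ and $P[x]$); Replacement (for every $a$ and every function $f$ from the elements of $a$ to $\mathbb W$ there is a $b$ whose elements are exactly the values of $f$). -/

import Mathlib

universe u v

namespace ObjGen

/-! ## Pairings

A binary pairing on `A` is a two-valued function of two variables, i.e. `ε : A → A → Prop`;
`ε x a` is read as "`x` is an element of `a`". Binary functions on `A` are identified with
their supports `Set A`. A domain `A` is a *set* when it is `u`-small; the ordinals
`Ordinal.{u}` are a domain that is not a set. -/

/-- The opposite adjoint `a ↦ ε[#, a]` of a pairing. -/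
def opAdj {A : Type v} (ε : A → A → Prop) (a : A) : Set A :=
  {x | ε x a}

/-- `B` is `ε`-transitive: `b ∈ B` and `ε a b` imply `a ∈ B`. -/
def IsTransitiveIn {A : Type v} (ε : A → A → Prop) (B : Set A) : Prop :=
  ∀ a b, b ∈ B → ε a b → a ∈ B

/-- A pairing is well-founded if its domain is a set, and the complement of every transitive
subdomain, if nonempty, has a minimal element (an element all of whose `ε`-predecessors lie
in the subdomain). -/
structure IsWellFoundedPairing {A : Type v} (ε : A → A → Prop) : Prop where
  isSet : Small.{u} A
  exists_minimal : ∀ B : Set A, IsTransitiveIn ε B → Bᶜ.Nonempty →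
    ∃ c, c ∉ B ∧ ∀ a, ε a c → a ∈ B

/-- The transitive closure of `B`: all `a` for which there is a chain
`a = cₙ ε cₙ₋₁ ε ⋯ ε c₀ ∈ B` with `n ≥ 1`. -/
def tcl {A : Type v} (ε : A → A → Prop) (B : Set A) : Set A :=
  {a | ∃ b ∈ B, Relation.TransGen ε a b}

/-- A pairing is almost well-founded if its restriction to the transitive closure of any point
is well-founded. -/
def IsAlmostWellFounded {A : Type v} (ε : A → A → Prop) : Prop :=
  ∀ a : A, IsWellFoundedPairing.{u} (fun x y : tcl ε {a} => ε x y)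

/-- A pairing is extensional if its opposite adjoint is injective. -/
def IsExtensional {A : Type v} (ε : A → A → Prop) : Prop :=
  Function.Injective (opAdj ε)

/-- `f` is a morphism of pairings: the two-valued function `ε` is the pullback of `δ` along `f`.
(Equivalently, a morphism from `ε` to the restriction of `δ` to the image of `f`.) -/
def IsPairingMorphism {A B : Type*} (ε : A → A → Prop) (δ : B → B → Prop) (f : A → B) : Prop :=
  ∀ x y, ε x y ↔ δ (f x) (f y)

/-! ## Beth rank -/

/-- The Beth function as a function from ordinals to ordinals. -/
noncomputable def bethOrd (a : Ordinal.{u}) : Ordinal.{u} :=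
  (Cardinal.beth a).ord

/-- The Beth rank of an ordinal: the least `a` with `x < ℶ_ a`. -/
noncomputable def rank (x : Ordinal.{u}) : Ordinal.{u} :=
  sInf {a | x < bethOrd a}

/-- The Beth rank of a bounded binary function: the supremum (least upper bound) of the ranks of
the elements of its support. -/
noncomputable def setRank (h : Set Ordinal.{u}) : Ordinal.{u} :=
  sInf {r | ∀ x ∈ h, rank x ≤ r}

/-! ## The distinguished pairings on the ordinals -/

/-- The defining properties of the pairing `∈` on the ordinals. In `on_nat`, bounded binary
functions on `ℕ` are finite sets of natural numbers, ordered by their largest difference (the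
colexicographic order), and `Finset.orderIsoColex` is the (unique) order isomorphism from `ℕ`
to these. -/
structure IsBethPairing (mem : Ordinal.{u} → Ordinal.{u} → Prop) : Prop where
  bijOn : Set.BijOn (opAdj mem) Set.univ {h | BddAbove h}
  on_nat : ∀ n : ℕ, opAdj mem (n : Ordinal.{u}) =
    (fun k : ℕ => (k : Ordinal.{u})) '' {k : ℕ | k ∈ ofColex (Finset.orderIsoColex n)}
  rank_eq : ∀ x : Ordinal.{u}, x ∉ Set.range (fun n : ℕ => (n : Ordinal.{u})) →
    rank x = setRank (opAdj mem x) + 1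

/-! ## The axioms of set theory -/

/-- The ZFC axioms for a pairing, with Separation and Replacement for arbitrary predicates and
functions. The fields `pairing`, `inductive_set` and `internal_choice` are the usual versions of
Pairing, Infinity and Choice. -/
structure SatisfiesZFCMinusOne {U : Type v} (ε : U → U → Prop) : Prop where
  /-- Regularity -/
  almostWellFounded : IsAlmostWellFounded.{u} ε
  extensionality : ∀ a b, opAdj ε a = opAdj ε b → a = b
  pairing : ∀ a b, ∃ c, ∀ x, ε x c ↔ x = a ∨ x = b
  union : ∀ a, ∃ c, ∀ x, ε x c ↔ ∃ b, ε x b ∧ ε b a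
  powerset : ∀ a, ∃ p, ∀ b, ε b p ↔ opAdj ε b ⊆ opAdj ε a
  infinity : ∃ a, (opAdj ε a).Infinite
  /-- There is a set that contains the empty set and is closed under `x ↦ x ∪ {x}`. -/
  inductive_set : ∃ a, (∃ e, ε e a ∧ opAdj ε e = ∅) ∧
    ∀ x, ε x a → ∃ s, ε s a ∧ opAdj ε s = insert x (opAdj ε x)
  /-- A partially defined function picks an element outside each set that is not everything. -/
  choice : ∃ ch : {a : U // opAdj ε a ≠ Set.univ} → U, ∀ a, ¬ ε (ch a) a
  /-- Every set of nonempty, pairwise disjoint sets has a transversal. -/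
  internal_choice : ∀ a, (∀ b, ε b a → (opAdj ε b).Nonempty) →
    (∀ b c, ε b a → ε c a → b ≠ c → Disjoint (opAdj ε b) (opAdj ε c)) →
    ∃ t, ∀ b, ε b a → ∃! x, ε x b ∧ ε x t
  separation : ∀ (P : U → Prop) (a : U), ∃ b, ∀ x, ε x b ↔ ε x a ∧ P x
  replacement : ∀ (a : U) (f : opAdj ε a → U), ∃ b, opAdj ε b = Set.range f

end ObjGen

namespace ObjGen

open Cardinal Ordinal Set

/-! Existence is a cardinality count. Infinite ordinals have successor rank, so the levels
`rankLevel a`, i.e. the intervals from ℶ_a to ℶ_{a+1}, partition them; each has cardinality 2^ℶ_a.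
So does `setRankLevel a`, which is all but a negligible part of the powerset of ℶ_a. Arbitrary
bijections between matching levels, glued to the colex order on ℕ, give the pairing.

For any such pairing, membership lowers (rank, value) lexicographically, hence is well-founded.
Bounded sets of ordinals are exactly the small ones, so every small set has a unique code.
Universality is then Mostowski collapse, and each existence axiom reduces to checking that some set
is small. -/

theorem bethOrd_strictMono : StrictMono bethOrd.{u} :=
  fun _ _ h => Cardinal.ord_lt_ord.2 (Cardinal.beth_strictMono h)

theorem bethOrd_zero : bethOrd.{u} 0 = ω := by simp [bethOrd]

theorem lt_bethOrd_add_one (x : Ordinal.{u}) : x < bethOrd (x + 1) :=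
  Cardinal.lt_ord.2 ((Ordinal.card_le_beth x).trans_lt
    (Cardinal.beth_strictMono (lt_add_one x)))

theorem rank_le_iff {x a : Ordinal.{u}} : rank x ≤ a ↔ x < bethOrd a := by
  refine ⟨fun h => ?_, fun h => csInf_le' h⟩
  have : x < bethOrd (rank x) :=
    csInf_mem (s := {a | x < bethOrd a}) ⟨_, lt_bethOrd_add_one x⟩
  exact this.trans_le (bethOrd_strictMono.monotone h)

theorem rank_mono : Monotone rank.{u} :=
  fun _ _ h => rank_le_iff.2 (h.trans_lt (rank_le_iff.1 le_rfl))

theorem rank_eq_zero_iff {x : Ordinal.{u}} : rank x = 0 ↔ x < ω := by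
  rw [← nonpos_iff_eq_zero, rank_le_iff, bethOrd_zero]

theorem mem_range_natCast_iff {x : Ordinal.{u}} :
    x ∈ range (fun n : ℕ => (n : Ordinal.{u})) ↔ x < ω := by
  simp [Ordinal.lt_omega0, eq_comm]

/-- The rank of an infinite ordinal is a successor. -/
theorem exists_rank_eq_add_one {x : Ordinal.{u}} (hx : ω ≤ x) : ∃ a, rank x = a + 1 := by
  rcases Ordinal.zero_or_succ_or_isSuccLimit (rank x) with h | ⟨a, h⟩ | h
  · exact absurd (rank_eq_zero_iff.1 h) hx.not_gt
  · exact ⟨a, h.symm⟩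
  -- ℶ is continuous at limits, so `x` already lies below an earlier ℶ, against minimality of the
  -- rank.
  · have h1 : x.card < Cardinal.beth (rank x) := Cardinal.lt_ord.1 (rank_le_iff.1 le_rfl)
    obtain ⟨b, hb, hxb⟩ := (Cardinal.isNormal_beth.lt_iff_exists_lt h).1 h1
    exact absurd (rank_le_iff.2 (Cardinal.lt_ord.2 hxb)) hb.not_ge

theorem setRank_le_iff {h : Set Ordinal.{u}} (hh : BddAbove h) {a : Ordinal.{u}} :
    setRank h ≤ a ↔ h ⊆ Iio (bethOrd a) := by
  have hne : {r | ∀ x ∈ h, rank x ≤ r}.Nonempty := by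
    obtain ⟨b, hb⟩ := hh
    exact ⟨rank b, fun x hx => rank_mono (hb hx)⟩
  refine ⟨fun H x hx => rank_le_iff.1 ((csInf_mem hne x hx).trans H), fun H => csInf_le' ?_⟩
  exact fun x hx => rank_le_iff.2 (H hx)

theorem rank_le_setRank {h : Set Ordinal.{u}} (hh : BddAbove h) {x : Ordinal.{u}} (hx : x ∈ h) :
    rank x ≤ setRank h :=
  rank_le_iff.2 ((setRank_le_iff hh).1 le_rfl hx)

/-! ### Counting the levels -/

/-- The ordinals of rank `a + 1`. -/
def rankLevel (a : Ordinal.{u}) : Set Ordinal.{u} := {x | rank x = a + 1}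

theorem rankLevel_eq (a : Ordinal.{u}) :
    rankLevel a = Iio (bethOrd (a + 1)) \ Iio (bethOrd a) := by
  ext x
  simp only [rankLevel, mem_ofPred_eq, mem_sdiff, mem_Iio, ← rank_le_iff, not_le]
  rw [← Order.succ_eq_add_one, ← Order.succ_le_iff (a := a), le_antisymm_iff]

theorem mk_Iio_bethOrd (a : Ordinal.{u}) :
    #(Iio (bethOrd a)) = Cardinal.lift.{u + 1} (Cardinal.beth a) := by
  rw [Cardinal.mk_Iio_ordinal, bethOrd, Cardinal.card_ord]

theorem mk_rankLevel (a : Ordinal.{u}) :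
    #(rankLevel a) = Cardinal.lift.{u + 1} (2 ^ Cardinal.beth a) := by
  rw [rankLevel_eq, ← Cardinal.beth_add_one, ← mk_Iio_bethOrd]
  refine Cardinal.eq_of_add_eq_of_aleph0_le
    (a := #(Iio (bethOrd a))) ?_ ?_ ?_
  · rw [add_comm]
    exact Cardinal.mk_sdiff_add_mk (Iio_subset_Iio (bethOrd_strictMono.monotone le_self_add))
  · rw [mk_Iio_bethOrd, mk_Iio_bethOrd, Cardinal.lift_lt]
    exact Cardinal.beth_strictMono (lt_add_one a)
  · rw [mk_Iio_bethOrd, Cardinal.aleph0_le_lift]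
    exact Cardinal.aleph0_le_beth _

/-- The set of ordinals corresponding to a finite set of natural numbers. -/
def finsetCast (s : Finset ℕ) : Set Ordinal.{u} := (fun k : ℕ => (k : Ordinal.{u})) '' s

theorem finsetCast_injective : Function.Injective finsetCast.{u} := fun _ _ h =>
  Finset.coe_injective (image_injective.2 (Nat.cast_injective (R := Ordinal.{u})) h)

theorem finsetCast_subset (s : Finset ℕ) : finsetCast.{u} s ⊆ Iio ω := by
  rintro _ ⟨k, -, rfl⟩
  exact Ordinal.natCast_lt_omega0 k

/-- The bounded sets of rank `a`, without the finite sets of natural numbers. -/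
def setRankLevel (a : Ordinal.{u}) : Set (Set Ordinal.{u}) :=
  {h | BddAbove h ∧ setRank h = a ∧ h ∉ range finsetCast}

theorem setRankLevel_subset (a : Ordinal.{u}) : setRankLevel a ⊆ 𝒫 (Iio (bethOrd a)) :=
  fun _ hh => (setRank_le_iff hh.1).1 hh.2.1.le

/-- Of a subset of `bethOrd a` and its complement, at least one has full rank. -/
theorem mem_setRankLevel_or_compl {a : Ordinal.{u}} {h : Set Ordinal.{u}}
    (hh : h ⊆ Iio (bethOrd a)) :
    h ∈ setRankLevel a ∨ Iio (bethOrd a) \ h ∈ setRankLevel a := by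
  have bdd : ∀ {s : Set Ordinal.{u}}, s ⊆ Iio (bethOrd a) → BddAbove s :=
    fun hs => bddAbove_Iio.mono hs
  -- A finite set of naturals lies below ℶ_0, so for `a ≠ 0` it is covered by the first alternative.
  have key : ∀ {s : Set Ordinal.{u}}, s ⊆ Iio (bethOrd a) → s ∉ setRankLevel a →
      (∃ b < a, s ⊆ Iio (bethOrd b)) ∨ (a = 0 ∧ s.Finite) := by
    intro s hs hn
    rcases ((setRank_le_iff (bdd hs)).2 hs).lt_or_eq with hlt | heq
    · exact .inl ⟨_, hlt, (setRank_le_iff (bdd hs)).1 le_rfl⟩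
    · have : s ∈ range finsetCast := by
        by_contra hc
        exact hn ⟨bdd hs, heq, hc⟩
      obtain ⟨t, rfl⟩ := this
      rcases eq_or_ne a 0 with ha | ha
      · exact .inr ⟨ha, t.finite_toSet.image _⟩
      · refine .inl ⟨0, pos_iff_ne_zero.2 ha, ?_⟩
        rw [bethOrd_zero]
        exact finsetCast_subset t
  by_contra! hcon
  rcases key hh hcon.1 with ⟨b, hb, h1⟩ | ⟨ha, h1⟩
  · rcases key sdiff_subset hcon.2 with ⟨c, hc, h2⟩ | ⟨ha, -⟩
    -- This point of ℶ_a would be too large for both `h` and its complement.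
    · have hmem : bethOrd (max b c) ∈ Iio (bethOrd a) := bethOrd_strictMono (max_lt hb hc)
      by_cases hm : bethOrd (max b c) ∈ h
      · exact (h1 hm).not_ge (bethOrd_strictMono.monotone (le_max_left _ _))
      · exact (h2 ⟨hmem, hm⟩).not_ge (bethOrd_strictMono.monotone (le_max_right _ _))
    · exact absurd hb (by simp [ha])
  · rcases key sdiff_subset hcon.2 with ⟨c, hc, -⟩ | ⟨-, h2⟩
    · exact absurd hc (by simp [ha])
    · have hfin : (Iio (bethOrd a)).Finite := by
        rw [← union_sdiff_cancel hh]
        exact h1.union h2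
      refine (Cardinal.lt_aleph0_iff_set_finite.2 hfin).not_ge ?_
      rw [mk_Iio_bethOrd, Cardinal.aleph0_le_lift]
      exact Cardinal.aleph0_le_beth _

/-- The level and its complements cover the powerset, which is infinite; hence the level is infinite
and absorbs the doubling. -/
theorem mk_setRankLevel (a : Ordinal.{u}) :
    #(setRankLevel a) = Cardinal.lift.{u + 1} (2 ^ Cardinal.beth a) := by
  have hP : #(𝒫 (Iio (bethOrd a))) = Cardinal.lift.{u + 1} (2 ^ Cardinal.beth a) := by
    rw [Cardinal.mk_powerset, mk_Iio_bethOrd, Cardinal.lift_two_power]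
  refine le_antisymm (hP ▸ Cardinal.mk_le_mk_of_subset (setRankLevel_subset a)) ?_
  have hle : #(𝒫 (Iio (bethOrd a))) ≤ #(setRankLevel a) + #(setRankLevel a) := by
    refine (Cardinal.mk_le_mk_of_subset (t := setRankLevel a ∪
      (fun h => Iio (bethOrd a) \ h) '' setRankLevel a) fun h hh => ?_).trans
      ((Cardinal.mk_union_le _ _).trans (add_le_add le_rfl Cardinal.mk_image_le))
    rcases mem_setRankLevel_or_compl hh with h1 | h1
    · exact .inl h1
    · exact .inr ⟨_, h1, sdiff_sdiff_eq_self hh⟩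
  have hinf : ℵ₀ ≤ #(𝒫 (Iio (bethOrd a))) := by
    rw [hP, Cardinal.aleph0_le_lift]
    exact (Cardinal.aleph0_le_beth a).trans (Cardinal.cantor _).le
  rw [← hP]
  rcases lt_or_ge #(setRankLevel a) ℵ₀ with hlt | hge
  · exact absurd (hinf.trans hle) (Cardinal.add_lt_aleph0 hlt hlt).not_ge
  · rwa [Cardinal.add_eq_self hge] at hle

theorem exists_bijOn_rankLevel (a : Ordinal.{u}) :
    ∃ f : Ordinal.{u} → Set Ordinal.{u}, BijOn f (rankLevel a) (setRankLevel a) := by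
  obtain ⟨e⟩ := Cardinal.eq.1 ((mk_rankLevel a).trans (mk_setRankLevel a).symm)
  classical
  refine ⟨fun x => if hx : x ∈ rankLevel a then e ⟨x, hx⟩ else ∅, fun x hx => ?_,
    fun x hx y hy hxy => ?_, fun s hs => ⟨e.symm ⟨s, hs⟩, Subtype.coe_prop _, ?_⟩⟩
  · simp [hx]
  · simpa [hx, hy, Subtype.coe_inj] using hxy
  · simp

/-! ### Gluing the levels -/

theorem exists_isBethPairing : ∃ mem : Ordinal.{u} → Ordinal.{u} → Prop, IsBethPairing mem := by
  classical
  choose f hf using exists_bijOn_rankLevel.{u}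
  -- `p x` is the predecessor of the rank; the value at finite `x` is junk.
  have hp : ∀ x : Ordinal.{u}, ∃ a, ω ≤ x → rank x = a + 1 := fun x => by
    by_cases hx : ω ≤ x
    · exact (exists_rank_eq_add_one hx).imp fun _ h _ => h
    · exact ⟨0, fun h => absurd h hx⟩
  choose p hp using hp
  have hn : ∀ x : Ordinal.{u}, ∃ n : ℕ, x < ω → x = n := fun x => by
    by_cases hx : x < ω
    · exact (Ordinal.lt_omega0.1 hx).imp fun _ h _ => h
    · exact ⟨0, fun h => absurd h hx⟩
  choose n hn using hn
  let F : Ordinal.{u} → Set Ordinal.{u} := fun x =>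
    if x < ω then finsetCast (ofColex (Finset.orderIsoColex (n x))) else f (p x) x
  have hFn : ∀ k : ℕ, F k = finsetCast (ofColex (Finset.orderIsoColex k)) := fun k => by
    have hk := Ordinal.natCast_lt_omega0.{u} k
    have : n (k : Ordinal.{u}) = k := Nat.cast_injective (hn _ hk).symm
    simp only [F, if_pos hk, this]
  have hFi : ∀ x, ω ≤ x → F x = f (p x) x := fun x hx => by simp only [F, if_neg hx.not_gt]
  have hFm : ∀ x, ω ≤ x → F x ∈ setRankLevel (p x) := fun x hx => by
    rw [hFi x hx]
    exact (hf _).mapsTo (hp x hx)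
  have hFne : ∀ x (k : ℕ), ω ≤ x → F k ≠ F x := fun x k hx h =>
    (hFm x hx).2.2 ⟨_, (hFn k).symm.trans h⟩
  refine ⟨fun y x => y ∈ F x, ⟨fun x _ => ?_, fun x _ y _ hxy => ?_, fun h hh => ?_⟩, hFn,
    fun x hx => ?_⟩
  · change BddAbove (F x)
    rcases lt_or_ge x ω with hx | hx
    · obtain ⟨k, rfl⟩ := Ordinal.lt_omega0.1 hx
      rw [hFn]
      exact bddAbove_Iio.mono (finsetCast_subset _)
    · exact (hFm x hx).1
  · change F x = F y at hxy
    rcases lt_or_ge x ω with hx | hx <;> rcases lt_or_ge y ω with hy | hy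
    · obtain ⟨k, rfl⟩ := Ordinal.lt_omega0.1 hx
      obtain ⟨l, rfl⟩ := Ordinal.lt_omega0.1 hy
      rw [hFn, hFn] at hxy
      exact congrArg _ (Finset.orderIsoColex.injective
        (ofColex.injective (finsetCast_injective hxy)))
    · obtain ⟨k, rfl⟩ := Ordinal.lt_omega0.1 hx
      exact absurd hxy (hFne y k hy)
    · obtain ⟨k, rfl⟩ := Ordinal.lt_omega0.1 hy
      exact absurd hxy.symm (hFne x k hx)
    · have hpe : p x = p y := by rw [← (hFm x hx).2.1, hxy, (hFm y hy).2.1]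
      rw [hFi x hx, hFi y hy, hpe] at hxy
      exact (hf (p y)).injOn (hpe ▸ hp x hx) (hp y hy) hxy
  · change ∃ x, x ∈ Set.univ ∧ F x = h
    by_cases hfin : h ∈ range finsetCast
    · obtain ⟨s, rfl⟩ := hfin
      refine ⟨(Finset.orderIsoColex.symm (toColex s) : ℕ), mem_univ _, ?_⟩
      rw [hFn, OrderIso.apply_symm_apply, ofColex_toColex]
    · obtain ⟨x, hx, hxh⟩ := (hf (setRank h)).surjOn ⟨hh, rfl, hfin⟩
      have hx' : rank x = setRank h + 1 := hx
      have hxω : ω ≤ x := by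
        by_contra hlt
        rw [rank_eq_zero_iff.2 (not_le.1 hlt)] at hx'
        exact absurd hx'.symm (by simp)
      have hpx : p x = setRank h := by
        have := (hp x hxω).symm.trans hx'
        simpa using this
      exact ⟨x, mem_univ _, by rw [hFi x hxω, hpx, hxh]⟩
  · have hx' : ω ≤ x := not_lt.1 fun h => hx (mem_range_natCast_iff.2 h)
    change rank x = setRank (F x) + 1
    rw [(hFm x hx').2.1, hp x hx']

/-- The colex isomorphism reads off binary digits, and `k < 2 ^ k ≤ n` when digit `k` of `n` is set.
-/
theorem lt_of_mem_orderIsoColex {k n : ℕ} (h : k ∈ ofColex (Finset.orderIsoColex n)) :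
    k < n := by
  have hn : n = ∑ i ∈ ofColex (Finset.orderIsoColex n), 2 ^ i :=
    (Finset.orderIsoColex.symm_apply_apply n).symm
  calc k < 2 ^ k := k.lt_two_pow_self
    _ ≤ ∑ i ∈ ofColex (Finset.orderIsoColex n), 2 ^ i :=
      Finset.single_le_sum (f := fun i => 2 ^ i) (fun _ _ => Nat.zero_le _) h
    _ = n := hn.symm

/-! ### Almost well-founded pairings -/

section AlmostWellFounded

variable {A : Type v} {ε : A → A → Prop}

theorem tcl_trans {a x y : A} (hy : y ∈ tcl ε {a}) (h : ε x y) : x ∈ tcl ε {a} := by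
  obtain ⟨b, hb, hyb⟩ := hy
  exact ⟨b, hb, .head h hyb⟩

theorem mem_tcl_of_rel {a x : A} (h : ε x a) : x ∈ tcl ε {a} := ⟨a, rfl, .single h⟩

theorem IsAlmostWellFounded.small_opAdj (h : IsAlmostWellFounded.{u} ε) (a : A) :
    Small.{u} (opAdj ε a) := by
  have := (h a).isSet
  exact small_subset fun x (hx : ε x a) => mem_tcl_of_rel hx

theorem IsAlmostWellFounded.wellFounded (h : IsAlmostWellFounded.{u} ε) : WellFounded ε := by
  refine ⟨fun a => ⟨a, fun y hy => ?_⟩⟩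
  have key : ∀ y : tcl ε {a}, Acc ε y := by
    by_contra! hcon
    -- The accessible points form a transitive subdomain, and a minimal point outside it would be
    -- accessible.
    obtain ⟨c, hc, hmin⟩ := (h a).exists_minimal {y | Acc ε y} (fun _ _ hb hab => hb.inv hab) hcon
    exact hc ⟨_, fun x hx => hmin ⟨x, tcl_trans c.2 hx⟩ hx⟩
  exact key ⟨y, mem_tcl_of_rel hy⟩

theorem isAlmostWellFounded_of_wellFounded (hwf : WellFounded ε)
    (hs : ∀ a, Small.{u} (tcl ε {a})) : IsAlmostWellFounded.{u} ε := fun a =>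
  ⟨hs a, fun B _ hne => by
    have hwf' : WellFounded fun x y : tcl ε {a} => ε x y := InvImage.wf Subtype.val hwf
    obtain ⟨c, hc, hmin⟩ := hwf'.has_min _ hne
    exact ⟨c, hc, fun x hx => by_contra fun hxB => hmin x hxB hx⟩⟩

end AlmostWellFounded

/-! ### Universality and the axioms -/

namespace IsBethPairing

variable {mem : Ordinal.{u} → Ordinal.{u} → Prop} (hm : IsBethPairing mem)
include hm

theorem bddAbove_opAdj (x : Ordinal.{u}) : BddAbove (opAdj mem x) :=
  hm.bijOn.mapsTo (mem_univ x)

theorem small_opAdj (x : Ordinal.{u}) : Small.{u} (opAdj mem x) :=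
  Ordinal.bddAbove_iff_small.1 (hm.bddAbove_opAdj x)

theorem ext {x y : Ordinal.{u}} (h : opAdj mem x = opAdj mem y) : x = y :=
  hm.bijOn.injOn (mem_univ x) (mem_univ y) h

theorem exists_opAdj_eq (s : Set Ordinal.{u}) [Small.{u} s] : ∃ x, opAdj mem x = s := by
  obtain ⟨x, -, hx⟩ := hm.bijOn.surjOn (Ordinal.bddAbove_iff_small.2 ‹_› : s ∈ {h | BddAbove h})
  exact ⟨x, hx⟩

/-- The second alternative is needed for finite ordinals, which all have rank 0. -/
theorem rank_lt_or_lt {x y : Ordinal.{u}} (h : mem y x) :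
    rank y < rank x ∨ rank y = rank x ∧ y < x := by
  by_cases hx : x ∈ range (fun n : ℕ => (n : Ordinal.{u}))
  · obtain ⟨n, rfl⟩ := hx
    have hy : y ∈ opAdj mem (n : Ordinal.{u}) := h
    rw [hm.on_nat] at hy
    obtain ⟨k, hk, rfl⟩ := hy
    have hkn : (k : Ordinal.{u}) < n := Nat.cast_lt.2 (lt_of_mem_orderIsoColex hk)
    refine .inr ⟨?_, hkn⟩
    exact (rank_eq_zero_iff.2 (Ordinal.natCast_lt_omega0 k)).trans
      (rank_eq_zero_iff.2 (Ordinal.natCast_lt_omega0 n)).symm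
  · left
    rw [hm.rank_eq x hx]
    exact (rank_le_setRank (hm.bddAbove_opAdj x) h).trans_lt (lt_add_one _)

theorem wellFounded : WellFounded mem := by
  refine Subrelation.wf (r := InvImage (Prod.Lex (· < ·) (· < ·))
    fun x : Ordinal.{u} => (rank x, x)) (fun {y x} h => ?_)
    (InvImage.wf _ (wellFounded_lt.prod_lex wellFounded_lt))
  rw [InvImage, Prod.lex_def]
  exact hm.rank_lt_or_lt h

theorem isAlmostWellFounded : IsAlmostWellFounded.{u} mem := by
  refine isAlmostWellFounded_of_wellFounded hm.wellFounded fun a => ?_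
  refine Ordinal.bddAbove_iff_small.1 (bddAbove_Iio (a := bethOrd (rank a)) |>.mono ?_)
  rintro x ⟨b, rfl, hxb⟩
  refine rank_le_iff.1 ?_
  have step : ∀ {y x}, mem y x → rank y ≤ rank x := fun h =>
    (hm.rank_lt_or_lt h).elim le_of_lt fun h => h.1.le
  induction hxb with
  | single h => exact step h
  | tail _ h ih => exact ih.trans (step h)

/-- Every almost well-founded extensional pairing embeds uniquely as a transitive subdomain. -/
theorem existsUnique_embedding {A : Type v} {ε : A → A → Prop}
    (hε : IsAlmostWellFounded.{u} ε) (hext : IsExtensional ε) :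
    ∃! f : A → Ordinal.{u}, Function.Injective f ∧
      IsTransitiveIn mem (range f) ∧ IsPairingMorphism ε mem f := by
  have hwf := hε.wellFounded
  have hcode : ∀ s : Set Ordinal.{u}, ∃ x, Small.{u} s → opAdj mem x = s := fun s => by
    by_cases hs : Small.{u} s
    · exact (hm.exists_opAdj_eq s).imp fun _ h _ => h
    · exact ⟨0, fun h => absurd h hs⟩
  choose code hcode using hcode
  -- Mostowski collapse: `f a` codes the set of values of `f` on the elements of `a`.
  let f : A → Ordinal.{u} := hwf.fix fun a ih => code (range fun x : opAdj ε a => ih x x.2)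
  have hf : ∀ a, opAdj mem (f a) = f '' opAdj ε a := fun a => by
    have := hε.small_opAdj a
    have h1 : f a = code (range fun x : opAdj ε a => f x) := hwf.fix_eq _ a
    rw [h1, hcode _ inferInstance, image_eq_range]
  have hinj : Function.Injective f := by
    intro a
    induction a using hwf.induction with
    | _ a ih =>
      intro b hab
      have himg : f '' opAdj ε a = f '' opAdj ε b := by rw [← hf, ← hf, hab]
      refine hext (Subset.antisymm (fun x hx => ?_) fun y hy => ?_)
      · obtain ⟨y, hy, hyx⟩ := himg ▸ mem_image_of_mem f hx
        rwa [ih x hx hyx.symm]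
      · obtain ⟨x, hx, hxy⟩ := himg.symm ▸ mem_image_of_mem f hy
        rwa [← ih x hx hxy]
  refine ⟨f, ⟨hinj, ?_, fun x y => ?_⟩, ?_⟩
  · rintro x _ ⟨b, rfl⟩ (hx : x ∈ opAdj mem (f b))
    rw [hf] at hx
    exact image_subset_range _ _ hx
  · change x ∈ opAdj ε y ↔ f x ∈ opAdj mem (f y)
    rw [hf, hinj.mem_set_image]
  · rintro g ⟨-, gtrans, gmor⟩
    funext a
    induction a using hwf.induction with
    | _ a ih =>
      refine hm.ext ?_
      rw [hf, ← image_congr (s := opAdj ε a) ih]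
      refine Subset.antisymm (fun x hx => ?_) ?_
      · obtain ⟨y, rfl⟩ := gtrans x (g a) ⟨a, rfl⟩ hx
        exact ⟨y, (gmor y a).2 hx, rfl⟩
      · rintro _ ⟨y, hy, rfl⟩
        exact (gmor y a).1 hy

theorem exists_powerset (a : Ordinal.{u}) :
    ∃ p, ∀ b, mem b p ↔ opAdj mem b ⊆ opAdj mem a := by
  have := hm.small_opAdj a
  have : Small.{u} {b | opAdj mem b ⊆ opAdj mem a} := by
    -- By extensionality, the codes of subsets of `a` inject into a small powerset.
    refine small_of_injective (β := Set (opAdj mem a))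
      (f := fun b => Subtype.val ⁻¹' opAdj mem b.1) fun b c hbc => Subtype.ext (hm.ext ?_)
    have h := congrArg (image Subtype.val) hbc
    simpa [Subtype.image_preimage_coe, inter_eq_right.2 b.2, inter_eq_right.2 c.2] using h
  obtain ⟨p, hp⟩ := hm.exists_opAdj_eq {b | opAdj mem b ⊆ opAdj mem a}
  exact ⟨p, fun b => Set.ext_iff.1 hp b⟩

theorem exists_inductive_set : ∃ a, (∃ e, mem e a ∧ opAdj mem e = ∅) ∧
    ∀ x, mem x a → ∃ s, mem s a ∧ opAdj mem s = insert x (opAdj mem x) := by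
  obtain ⟨e, he⟩ := hm.exists_opAdj_eq ∅
  have hsucc : ∀ x, ∃ s, opAdj mem s = insert x (opAdj mem x) := fun x => by
    have := hm.small_opAdj x
    exact hm.exists_opAdj_eq _
  choose S hS using hsucc
  -- The finite von Neumann ordinals, small because indexed by ℕ.
  obtain ⟨a, ha⟩ := hm.exists_opAdj_eq (range fun n : ℕ => S^[n] e)
  have ha' : ∀ x, mem x a ↔ ∃ n : ℕ, S^[n] e = x := Set.ext_iff.1 ha
  refine ⟨a, ⟨e, (ha' e).2 ⟨0, rfl⟩, he⟩, fun x hx => ?_⟩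
  obtain ⟨n, rfl⟩ := (ha' x).1 hx
  exact ⟨_, (ha' _).2 ⟨n + 1, Function.iterate_succ_apply' S n e⟩, hS _⟩

theorem satisfiesZFC : SatisfiesZFCMinusOne.{u} mem where
  almostWellFounded := hm.isAlmostWellFounded
  extensionality _ _ h := hm.ext h
  pairing a b := by
    obtain ⟨c, hc⟩ := hm.exists_opAdj_eq {a, b}
    exact ⟨c, Set.ext_iff.1 hc⟩
  union a := by
    have := hm.small_opAdj
    obtain ⟨c, hc⟩ := hm.exists_opAdj_eq (⋃ b : opAdj mem a, opAdj mem b)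
    refine ⟨c, fun x => (Set.ext_iff.1 hc x).trans ?_⟩
    simp [opAdj, and_comm]
  powerset := hm.exists_powerset
  infinity := by
    obtain ⟨a, ha⟩ := hm.exists_opAdj_eq (range fun n : ℕ => (n : Ordinal.{u}))
    exact ⟨a, ha ▸ infinite_range_of_injective Nat.cast_injective⟩
  inductive_set := hm.exists_inductive_set
  choice := by
    have h : ∀ a : {a // opAdj mem a ≠ Set.univ}, ∃ x, ¬ mem x a := fun a =>
      (ne_univ_iff_exists_notMem _).1 a.2
    choose ch hch using h
    exact ⟨ch, hch⟩
  internal_choice a hne hdis := by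
    have := hm.small_opAdj a
    have h : ∀ b : opAdj mem a, ∃ x, mem x b := fun b => hne b b.2
    choose g hg using h
    obtain ⟨t, ht⟩ := hm.exists_opAdj_eq (range g)
    have ht' : ∀ x, mem x t ↔ ∃ c, g c = x := Set.ext_iff.1 ht
    refine ⟨t, fun b hb => ⟨g ⟨b, hb⟩, ⟨hg ⟨b, hb⟩, (ht' _).2 ⟨_, rfl⟩⟩, ?_⟩⟩
    rintro x ⟨hxb, hxt⟩
    obtain ⟨c, rfl⟩ := (ht' x).1 hxt
    have hcb : c = ⟨b, hb⟩ := Subtype.ext <| by_contra fun hcb =>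
      disjoint_left.1 (hdis c b c.2 hb hcb) (hg c) hxb
    rw [hcb]
  separation P a := by
    have := hm.small_opAdj a
    have : Small.{u} {x | mem x a ∧ P x} := small_subset (s := opAdj mem a) fun _ h => h.1
    obtain ⟨b, hb⟩ := hm.exists_opAdj_eq {x | mem x a ∧ P x}
    exact ⟨b, Set.ext_iff.1 hb⟩
  replacement a f := by
    have := hm.small_opAdj a
    exact hm.exists_opAdj_eq _

end IsBethPairing

end ObjGen

theorem mainTheorem1 :
    -- Existence
    (∃ mem : Ordinal.{u} → Ordinal.{u} → Prop, ObjGen.IsBethPairing mem) ∧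
    ∀ mem : Ordinal.{u} → Ordinal.{u} → Prop, ObjGen.IsBethPairing mem →
      -- Universality
      (∀ (A : Type v) (ε : A → A → Prop),
        ObjGen.IsAlmostWellFounded.{u} ε → ObjGen.IsExtensional ε →
          ∃! ω : A → Ordinal.{u}, Function.Injective ω ∧
            ObjGen.IsTransitiveIn mem (Set.range ω) ∧ ObjGen.IsPairingMorphism ε mem ω) ∧
      -- Set theory
      ObjGen.SatisfiesZFCMinusOne.{u} mem :=
  ⟨ObjGen.exists_isBethPairing, fun _ hm =>
    ⟨fun _ _ hε hext => hm.existsUnique_embedding hε hext, hm.satisfiesZFC⟩⟩
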